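/- Theorem (Characterization of support measures). Let $d\ge 0$. A polyhedral cone in $\mathbb{R}^d$ is an intersection of finitely many closed half-spaces $\{x:\langle a,x\rangle\le 0\}$; let $\mathcal P(\mathbb{R}^d)$ be the set of these cones. For $C\in\mathcal P(\mathbb{R}^d)$ let $C^\circ=\{z:\langle x,z\rangle\le 0\ \forall x\in C\}$ be its polar cone and $$BL(C)=\{(x,z)\in C\times C^\circ:\langle x,z\rangle=0\}$$ its biconic lift. Let $\hat{\mathscr B}$ be the biconic $\sigma$-algebra of all Borel sets $M\subseteq\mathbb{R}^d\times\mathbb{R}^d$ with $\{(\lambda x,\lambda' x'):(x,x')\in M\}=M$ for all $\lambda,\lambda'>0$; a biconic measure is a $\sigma$-additive function $\hat{\mathscr B}\to\mathbb{R}$. For $Q\in O(d)$ put $QM=\{(Qx,Qx'):(x,x')\in M\}$. Let $\hat\Delta$ be the Dirac measure at $(0,0)$ on $\hat{\mathscr B}$. A face of $C$ is a set $\{x\in C:\langle x,z\rangle=0\}$ with $z\in C^\circ$; its dimension is that of its linear span. For $0\le k\le d$ let $S_k(C)$ be the union, over the $k$-dimensional faces $F$ of $C$, of the interior of $F$ relative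 to its linear span. With $\Pi_C$ and $\Pi_{C^\circ}$ the nearest-point maps onto $C$ and $C^\circ$ and $g$ a standard Gaussian vector in $\mathbb{R}^d$, the support measures are $$\Theta_k(C,M)=\mathbb{P}\{\Pi_C(g)\in S_k(C)\text{ and }(\Pi_C(g),\Pi_{C^\circ}(g))\in M\}\qquad(M\in\hat{\mathscr B}).$$ Let $\psi:\mathcal P(\mathbb{R}^d)\times\hat{\mathscr B}\to\mathbb{R}$ be such that for all $C,D\in\mathcal P(\mathbb{R}^d)$, $M\in\hat{\mathscr B}$ and $Q\in O(d)$: (0) $\psi(C,\cdot)$ is a biconic measure; (1) $\psi(C,M)=\psi(C,M\cap BL(C))$; (2) $\psi(QC,QM)=\psi(C,M)$; (3) $\psi(C,M)=\psi(D,M)$ whenever $BL(C)\cap M=BL(D)\cap M$. Then $\psi$ is a linear combination of $\hat\Delta$ and $\Theta_0,\dots,\Theta_d$ (with coefficients independent of $C$). More precisely, for any linear subspaces $L^{(k)}\subseteq\mathbb{R}^d$ with $\dim L^{(k)}=k$, $0\le k\le d$, and for all $C\in\mathcal P(\mathbb{R}^d)$ and $M\in\hat{\mathscr B}$, $$\psi(C,M)=\psi\big(\mathbb{R}^d,\{(0,0)\}\big)\,\hat\Delta(M)+\sum_{k=0}^d\psi\big(L^{(k)},(\mathbb{R}^d\times\mathbb{R}^d)\setminus\{(0,0)\}\big)\,\Theta_k(C,M).$$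 -/

import Mathlib

open MeasureTheory ProbabilityTheory

/-! ### Polyhedral cones -/

/-- The Euclidean space `ℝ^d`. -/
abbrev Euc (d : ℕ) : Type := EuclideanSpace ℝ (Fin d)

/-- A polyhedral cone in `ℝ^d`: an intersection of finitely many closed linear half-spaces,
`C = {x | ⟪a i, x⟫ ≤ 0 for all i}`. -/
def IsPolyhedralCone {d : ℕ} (C : Set (Euc d)) : Prop :=
  ∃ (m : ℕ) (a : Fin m → Euc d), C = {x | ∀ i, inner ℝ (a i) x ≤ 0}

/-- The set `P(ℝ^d)` of polyhedral cones. -/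
def PolyCone (d : ℕ) : Type := {C : Set (Euc d) // IsPolyhedralCone C}

/-- The underlying set of a polyhedral cone. -/
def PolyCone.carrier {d : ℕ} (C : PolyCone d) : Set (Euc d) := C.1

theorem IsPolyhedralCone.image {d : ℕ} {C : Set (Euc d)} (hC : IsPolyhedralCone C)
    (Q : Euc d ≃ₗᵢ[ℝ] Euc d) : IsPolyhedralCone (Q '' C) := by
  obtain ⟨m, a, rfl⟩ := hC
  refine ⟨m, fun i => Q (a i), ?_⟩
  ext y
  constructor
  · rintro ⟨x, hx, rfl⟩ i
    simpa using hx i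
  · intro hy
    refine ⟨Q.symm y, fun i => ?_, by simp⟩
    have h := hy i
    rw [← Q.apply_symm_apply y, Q.inner_map_map] at h
    exact h

theorem isPolyhedralCone_submodule {d : ℕ} (L : Submodule ℝ (Euc d)) :
    IsPolyhedralCone (L : Set (Euc d)) := by
  obtain ⟨n, s, hs⟩ := Submodule.fg_iff_exists_fin_generating_family.mp
    (IsNoetherian.noetherian Lᗮ)
  refine ⟨n + n, Fin.append s (-s), ?_⟩
  have key : ∀ x, x ∈ L ↔ ∀ i, inner ℝ (s i) x = 0 := by
    intro x
    rw [← Submodule.orthogonal_orthogonal L, Submodule.mem_orthogonal, ← hs]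
    constructor
    · intro h i
      exact h _ (Submodule.subset_span ⟨i, rfl⟩)
    · intro h u hu
      induction hu using Submodule.span_induction with
      | mem u hu => obtain ⟨i, rfl⟩ := hu; exact h i
      | zero => simp
      | add u v _ _ h1 h2 => rw [inner_add_left, h1, h2, add_zero]
      | smul c u _ h1 => rw [real_inner_smul_left, h1, mul_zero]
  ext x
  rw [SetLike.mem_coe, key]
  constructor
  · intro h i
    refine Fin.addCases (fun j => ?_) (fun j => ?_) i
    · rw [Fin.append_left, h j]
    · rw [Fin.append_right, Pi.neg_apply, inner_neg_left, h j, neg_zero]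
  · intro h i
    have h1 := h (Fin.castAdd n i)
    have h2 := h (Fin.natAdd n i)
    simp only [Fin.append_left, Fin.append_right, Pi.neg_apply, inner_neg_left] at h1 h2
    linarith

/-- The rotated cone `Q C` for an orthogonal transformation `Q`. -/
def PolyCone.map {d : ℕ} (Q : Euc d ≃ₗᵢ[ℝ] Euc d) (C : PolyCone d) : PolyCone d :=
  ⟨Q '' C.carrier, C.2.image Q⟩

/-- A linear subspace as a polyhedral cone. -/
def PolyCone.ofSubspace {d : ℕ} (L : Submodule ℝ (Euc d)) : PolyCone d :=
  ⟨L, isPolyhedralCone_submodule L⟩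

/-- The polar cone `C° = {z | ⟪x, z⟫ ≤ 0 for all x ∈ C}`, as a set. -/
def polarCone {d : ℕ} (C : Set (Euc d)) : Set (Euc d) :=
  {z | ∀ x ∈ C, inner ℝ x z ≤ 0}

/-- `F` is a face of `C`: `F = {x ∈ C | ⟪x, z⟫ = 0}` for some `z` with `⟪x, z⟫ ≤ 0` on `C`. -/
def IsConeFace {d : ℕ} (C F : Set (Euc d)) : Prop :=
  ∃ z : Euc d, (∀ x ∈ C, inner ℝ x z ≤ 0) ∧ F = {x ∈ C | inner ℝ x z = 0}

/-- `𝓛_k(C)`, the set of linear spans of the `k`-dimensional faces of `C`. -/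
def faceSpans {d : ℕ} (C : Set (Euc d)) (k : ℕ) : Set (Submodule ℝ (Euc d)) :=
  {L | ∃ F, IsConeFace C F ∧ L = Submodule.span ℝ F ∧ Module.finrank ℝ L = k}

/-- `int_L (C ∩ L)`, the interior of `C ∩ L` in the relative topology of the subspace `L`. -/
def interiorIn {d : ℕ} (L : Submodule ℝ (Euc d)) (C : Set (Euc d)) : Set (Euc d) :=
  Subtype.val '' interior {x : L | (x : Euc d) ∈ C}

/-- The `k`-skeleton `S_k(C)`, the union of the relative interiors of the `k`-dimensional faces. -/
def skeleton {d : ℕ} (C : Set (Euc d)) (k : ℕ) : Set (Euc d) :=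
  ⋃ L ∈ faceSpans C k, interiorIn L C

/-- `y` is a point of `C` nearest to `x`. -/
def IsNearestPoint {d : ℕ} (C : Set (Euc d)) (x y : Euc d) : Prop :=
  y ∈ C ∧ ∀ z ∈ C, ‖x - y‖ ≤ ‖x - z‖

/-- The metric projection `Π_C`, the (unique) nearest point of `C`; it is used only for closed
convex cones `C`, where `nearestPt_spec` and `IsNearestPoint.eq_nearestPt` apply. -/
noncomputable def nearestPt {d : ℕ} (C : Set (Euc d)) (x : Euc d) : Euc d :=
  Classical.epsilon (IsNearestPoint C x)

theorem nearestPt_spec {d : ℕ} {C : Set (Euc d)} (hC : IsClosed C) (hne : C.Nonempty)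
    (x : Euc d) : IsNearestPoint C x (nearestPt C x) := by
  apply Classical.epsilon_spec (p := IsNearestPoint C x)
  obtain ⟨y, hy, h⟩ := hC.exists_infDist_eq_dist hne x
  refine ⟨y, hy, fun z hz => ?_⟩
  rw [← dist_eq_norm, ← dist_eq_norm, ← h]
  exact Metric.infDist_le_dist_of_mem hz

theorem IsNearestPoint.eq_nearestPt {d : ℕ} {C : Set (Euc d)} (hC : IsClosed C)
    (hconv : Convex ℝ C) {x y : Euc d} (hy : IsNearestPoint C x y) : y = nearestPt C x := by
  obtain ⟨hw, hwmin⟩ := nearestPt_spec hC ⟨y, hy.1⟩ x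
  generalize nearestPt C x = w at hw hwmin
  have hm : (1 / 2 : ℝ) • y + (1 / 2 : ℝ) • w ∈ C :=
    hconv hy.1 hw (by norm_num) (by norm_num) (by norm_num)
  have e1 : ‖x - y‖ = ‖x - w‖ := le_antisymm (hy.2 w hw) (hwmin y hy.1)
  have e2 := hy.2 _ hm
  have e3 : x - ((1 / 2 : ℝ) • y + (1 / 2 : ℝ) • w) = (1 / 2 : ℝ) • ((x - y) + (x - w)) := by
    module
  rw [e3, norm_smul, Real.norm_of_nonneg (by norm_num)] at e2
  have e4 := parallelogram_law_with_norm ℝ (x - y) (x - w)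
  have e5 : (x - y) - (x - w) = w - y := by abel
  rw [e5, ← e1] at e4
  have e6 : ‖w - y‖ = 0 := by
    nlinarith [norm_nonneg (w - y), norm_nonneg (x - y), norm_nonneg ((x - y) + (x - w))]
  exact (sub_eq_zero.mp (norm_eq_zero.mp e6)).symm

/-! ### Biconic sets and measures -/

/-- The map `(x, x') ↦ (s x, t x')`, acting on sets `M ⊆ ℝ^d × ℝ^d`. -/
def biscale {d : ℕ} (s t : ℝ) (M : Set (Euc d × Euc d)) : Set (Euc d × Euc d) :=
  (fun p => (s • p.1, t • p.2)) '' M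

theorem biscale_bijective {d : ℕ} {s t : ℝ} (hs : 0 < s) (ht : 0 < t) :
    Function.Bijective (fun p : Euc d × Euc d => (s • p.1, t • p.2)) := by
  refine ⟨fun p q h => ?_, fun q => ⟨(s⁻¹ • q.1, t⁻¹ • q.2), ?_⟩⟩
  · simp only [Prod.mk.injEq] at h
    exact Prod.ext (smul_right_injective _ hs.ne' h.1) (smul_right_injective _ ht.ne' h.2)
  · simp [smul_smul, hs.ne', ht.ne']

/-- The biconic (Borel) `σ`-algebra on `ℝ^d × ℝ^d`: the Borel sets `M` with `(s, t) M = M`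
for all `s, t > 0`. -/
abbrev biconicAlgebra (d : ℕ) : MeasurableSpace (Euc d × Euc d) where
  MeasurableSet' M := MeasurableSet M ∧ ∀ s t : ℝ, 0 < s → 0 < t → biscale s t M = M
  measurableSet_empty := ⟨MeasurableSet.empty, fun _ _ _ _ => Set.image_empty _⟩
  measurableSet_compl M hM := ⟨hM.1.compl, fun s t hs ht => by
    have h := hM.2 s t hs ht
    unfold biscale at h ⊢
    rw [Set.image_compl_eq (biscale_bijective hs ht), h]⟩
  measurableSet_iUnion f hf := ⟨MeasurableSet.iUnion fun i => (hf i).1, fun s t hs ht => by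
    unfold biscale
    rw [Set.image_iUnion]
    exact Set.iUnion_congr fun i => (hf i).2 s t hs ht⟩

/-- Membership in the biconic `σ`-algebra. -/
def IsBiconic {d : ℕ} (M : Set (Euc d × Euc d)) : Prop :=
  MeasurableSet[biconicAlgebra d] M

/-- Biconic measures: `σ`-additive real-valued functions on the biconic `σ`-algebra. -/
abbrev BiconicMeasure (d : ℕ) : Type :=
  @SignedMeasure (Euc d × Euc d) (biconicAlgebra d)

/-- The biconic lift `{(x, z) ∈ C × C° | ⟪x, z⟫ = 0}`. -/
def biconicLift {d : ℕ} (C : PolyCone d) : Set (Euc d × Euc d) :=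
  {p | p.1 ∈ C.carrier ∧ p.2 ∈ polarCone C.carrier ∧ inner ℝ p.1 p.2 = 0}

/-- The simultaneous action `Q M = {(Q x, Q x') | (x, x') ∈ M}` of an orthogonal map. -/
def biRotate {d : ℕ} (Q : Euc d ≃ₗᵢ[ℝ] Euc d) (M : Set (Euc d × Euc d)) :
    Set (Euc d × Euc d) :=
  (fun p => (Q p.1, Q p.2)) '' M

/-- The biconic Dirac measure supported at the origin. -/
noncomputable def biDirac {d : ℕ} (M : Set (Euc d × Euc d)) : ℝ :=
  (Measure.dirac (0 : Euc d × Euc d)).real M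

/-- The support measure
`Θ_k(C, M) = ℙ(Π_C(g) ∈ S_k(C) and (Π_C(g), Π_{C°}(g)) ∈ M)`, with `g` standard Gaussian. -/
noncomputable def supportMeasure {d : ℕ} (k : ℕ) (C : PolyCone d)
    (M : Set (Euc d × Euc d)) : ℝ :=
  (stdGaussian (Euc d)).real
    {g | nearestPt C.carrier g ∈ skeleton C.carrier k ∧
      (nearestPt C.carrier g, nearestPt (polarCone C.carrier) g) ∈ M}

/-!
For a subspace `L`, the measure `ψ(L, ·)` is invariant under the compact group of orthogonal maps
preserving `L`. Up to positive rescalings of the two components, this group acts transitively on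
the pairs in `L × Lᗮ` with nonvanishing components, so averaging over it forces `ψ(L, ·)` to be
there a multiple of the law of `(P_L g, P_{Lᗮ} g)`, with `g` standard Gaussian. The remaining
nonzero pairs of `L × Lᗮ` lie in `{0} × ℝ^d` or `ℝ^d × {0}`; there locality replaces `L` by `⊥` or
`⊤`, and the corresponding Gaussian law does not charge `L × Lᗮ`.

The biconic lift of a cone `C` is partitioned according to the face of `C` containing the first
component in its relative interior. On each part locality replaces `C` by the span of that face,
and the Gaussian law of the span becomes the contribution of the face to a support measure.
-/

section InvariantMeasures

variable {G α : Type*} [Group G] [MulAction G α] [MeasurableSpace G] [mα : MeasurableSpace α]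
  [MeasurableSMul₂ G α]

theorem signedMeasure_eq_posPart_sub_negPart (s : SignedMeasure α) {M : Set α}
    (hM : MeasurableSet M) :
    s M = s.toJordanDecomposition.posPart.real M - s.toJordanDecomposition.negPart.real M := by
  conv_lhs => rw [← s.toSignedMeasure_toJordanDecomposition]
  exact Measure.toSignedMeasure_sub_apply hM

theorem integral_real_preimage_smul (h : Measure G) [IsFiniteMeasure h] (p : Measure α)
    [IsFiniteMeasure p] {M : Set α} (hM : MeasurableSet M) :
    ∫ g, p.real ((g • ·) ⁻¹' M) ∂h = ∫ x, h.real {g | g • x ∈ M} ∂p := by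
  have hS : MeasurableSet {q : G × α | q.1 • q.2 ∈ M} := measurable_smul hM
  calc ∫ g, p.real ((g • ·) ⁻¹' M) ∂h = (h.prod p).real {q : G × α | q.1 • q.2 ∈ M} := by
        rw [measureReal_def, Measure.prod_apply hS]
        exact integral_toReal (measurable_measure_prodMk_left hS).aemeasurable
          (.of_forall fun g => measure_lt_top _ _)
    _ = ∫ x, h.real {g | g • x ∈ M} ∂p := by
        rw [measureReal_def, Measure.prod_apply_symm hS]
        exact (integral_toReal (measurable_measure_prodMk_right hS).aemeasurable
          (.of_forall fun x => measure_lt_top _ _)).symm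

theorem integrable_real_preimage_smul (h : Measure G) [IsFiniteMeasure h] (p : Measure α)
    [IsFiniteMeasure p] {M : Set α} (hM : MeasurableSet M) :
    Integrable (fun g : G => p.real ((g • ·) ⁻¹' M)) h := by
  refine .of_bound (C := p.real Set.univ) ?_
    (.of_forall fun g => by
      rw [Real.norm_of_nonneg measureReal_nonneg]; exact measureReal_mono (Set.subset_univ _))
  exact (measurable_measure_prodMk_left (measurable_smul hM :
    MeasurableSet {q : G × α | q.1 • q.2 ∈ M})).ennreal_toReal.aestronglyMeasurable

/-- Averaging `s` over `G` turns it into the average of the orbit measures. -/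
theorem signedMeasure_eq_mul_of_measure_orbit (h : Measure G) [IsProbabilityMeasure h]
    {s : SignedMeasure α} {M A : Set α}
    (hs : ∀ g : G, s ((g • ·) ⁻¹' M) = s M) (hM : MeasurableSet M) (hA : MeasurableSet A) {c : ℝ}
    (hc : ∀ x, h.real {g | g • x ∈ M} = A.indicator (fun _ => c) x) : s M = s A * c := by
  have average (p : Measure α) [IsFiniteMeasure p] :
      ∫ g, p.real ((g • ·) ⁻¹' M) ∂h = p.real A * c := by
    simp_rw [integral_real_preimage_smul h p hM, hc, integral_indicator_const c hA, smul_eq_mul]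
  calc s M = ∫ g, s ((g • ·) ⁻¹' M) ∂h := by simp [hs]
    _ = s A * c := by
      simp_rw [fun g : G => signedMeasure_eq_posPart_sub_negPart s (measurable_const_smul g hM)]
      rw [integral_sub (integrable_real_preimage_smul h _ hM)
        (integrable_real_preimage_smul h _ hM), average, average,
        signedMeasure_eq_posPart_sub_negPart s hA, sub_mul]

theorem measure_orbit_eq_of_mem_measurableAtom [MeasurableMul G] (h : Measure G)
    [h.IsMulRightInvariant] {M : Set α} (hM : MeasurableSet M) {x y : α} {k : G}
    (hk : k • x ∈ measurableAtom y) : h {g | g • x ∈ M} = h {g | g • y ∈ M} := by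
  rw [← measure_preimage_mul_right h k {g | g • x ∈ M}]
  congr 1
  ext g
  have hgM : MeasurableSet ((g • ·) ⁻¹' M) := measurable_const_smul g hM
  simp only [Set.mem_preimage, Set.mem_ofPred_eq, mul_smul]
  exact ⟨fun hx => by_contra fun hy => mem_of_mem_measurableAtom hk hgM.compl hy hx,
    fun hy => mem_of_mem_measurableAtom hk hgM hy⟩

variable [TopologicalSpace G] [IsTopologicalGroup G] [CompactSpace G] [BorelSpace G]

theorem exists_isProbabilityMeasure_isMulRightInvariant :
    ∃ h : Measure G, IsProbabilityMeasure h ∧ h.IsMulRightInvariant := by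
  have : IsProbabilityMeasure (Measure.haarMeasure (⊤ : TopologicalSpace.PositiveCompacts G)) :=
    ⟨Measure.haarMeasure_self⟩
  refine ⟨(Measure.haarMeasure ⊤).inv, ⟨?_⟩, inferInstance⟩
  rw [Measure.inv_apply, Set.inv_univ, measure_univ]

/-- Transitivity is only asked up to points that `MeasurableSpace α` does not separate. -/
theorem signedMeasure_mul_eq_mul_of_smul_invariant {s σ : SignedMeasure α} {M A : Set α}
    (hs : ∀ g : G, s ((g • ·) ⁻¹' M) = s M) (hσ : ∀ g : G, σ ((g • ·) ⁻¹' M) = σ M)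
    (hM : MeasurableSet M) (hA : MeasurableSet A) (hMA : M ⊆ A)
    (hGA : ∀ (g : G) (x : α), g • x ∈ A → x ∈ A)
    (trans : ∀ x ∈ A, ∀ y ∈ A, ∃ k : G, k • x ∈ measurableAtom y) :
    s M * σ A = s A * σ M := by
  obtain ⟨h, _, _⟩ := exists_isProbabilityMeasure_isMulRightInvariant (G := G)
  obtain ⟨c, hc⟩ : ∃ c, ∀ x, h.real {g | g • x ∈ M} = A.indicator (fun _ => c) x := by
    rcases A.eq_empty_or_nonempty with rfl | ⟨y, hy⟩
    · exact ⟨0, fun x => by simp [Set.subset_empty_iff.1 hMA]⟩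
    refine ⟨h.real {g | g • y ∈ M}, fun x => ?_⟩
    by_cases hx : x ∈ A
    · obtain ⟨k, hk⟩ := trans x hx y hy
      rw [Set.indicator_of_mem hx, measureReal_def, measureReal_def,
        measure_orbit_eq_of_mem_measurableAtom h hM hk]
    · have : {g : G | g • x ∈ M} = ∅ :=
        Set.eq_empty_of_forall_notMem fun g hg => hx (hGA g x (hMA hg))
      rw [Set.indicator_of_notMem hx, this, measureReal_empty]
  rw [signedMeasure_eq_mul_of_measure_orbit h hs hM hA hc,
    signedMeasure_eq_mul_of_measure_orbit h hσ hM hA hc]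
  ring

end InvariantMeasures

section OrthogonalStabilizer

open scoped Pointwise

variable {E : Type*} [NormedAddCommGroup E] [InnerProductSpace ℝ E] [FiniteDimensional ℝ E]

instance : ContinuousSMul (E →L[ℝ] E) E :=
  ⟨isBoundedBilinearMap_apply.continuous⟩

instance : CompactSpace (unitary (E →L[ℝ] E)) := by
  have : ProperSpace (E →L[ℝ] E) := FiniteDimensional.proper ℝ _
  refine isCompact_iff_compactSpace.1 (Metric.isCompact_of_isClosed_isBounded isClosed_unitary ?_)
  refine (Metric.isBounded_closedBall (x := 0) (r := 1)).subset fun u hu =>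
    mem_closedBall_zero_iff.2 ?_
  exact u.opNorm_le_bound zero_le_one fun x => by
    rw [u.norm_map_of_mem_unitary hu, one_mul]

/-- The group of orthogonal transformations mapping `L` onto itself, taken inside the unitary
elements of `E →L[ℝ] E` so that it carries the operator norm topology. -/
noncomputable abbrev orthogonalStabilizer (L : Submodule ℝ E) : Subgroup (unitary (E →L[ℝ] E)) :=
  MulAction.stabilizer (unitary (E →L[ℝ] E)) L

theorem mem_orthogonalStabilizer {L : Submodule ℝ E} {u : unitary (E →L[ℝ] E)} :
    u ∈ orthogonalStabilizer L ↔ ∀ x ∈ L, u • x ∈ L := by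
  refine ⟨fun hu x hx => ?_, fun hu => ?_⟩
  · rw [← MulAction.mem_stabilizer_iff.1 hu]
    exact Submodule.smul_mem_pointwise_smul x u L hx
  · refine Submodule.eq_of_le_of_finrank_eq ?_
      ((Unitary.linearIsometryEquiv u).toLinearEquiv.finrank_map_eq L)
    rintro _ ⟨x, hx, rfl⟩
    exact hu x hx

instance (L : Submodule ℝ E) : CompactSpace (orthogonalStabilizer L) := by
  refine isCompact_iff_compactSpace.1 (IsClosed.isCompact ?_)
  have : (orthogonalStabilizer L : Set (unitary (E →L[ℝ] E))) = ⋂ x ∈ L, {u | u • x ∈ L} := by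
    ext u
    simp only [SetLike.mem_coe, mem_orthogonalStabilizer, Set.mem_iInter, Set.mem_ofPred_eq]
  rw [this]
  exact isClosed_biInter fun x _ =>
    L.closed_of_finiteDimensional.preimage (continuous_id.smul continuous_const)

theorem smul_mem_iff_of_orthogonalStabilizer {L : Submodule ℝ E} (u : orthogonalStabilizer L)
    {x : E} : u • x ∈ L ↔ x ∈ L := by
  refine ⟨fun h => ?_, mem_orthogonalStabilizer.1 u.2 x⟩
  rw [← inv_smul_smul u x]
  exact mem_orthogonalStabilizer.1 (u⁻¹).2 _ h

theorem orthogonalStabilizer_orthogonal (L : Submodule ℝ E) :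
    orthogonalStabilizer Lᗮ = orthogonalStabilizer L := by
  suffices h : ∀ L : Submodule ℝ E, orthogonalStabilizer L ≤ orthogonalStabilizer Lᗮ from
    le_antisymm ((h Lᗮ).trans_eq (by rw [L.orthogonal_orthogonal])) (h L)
  refine fun L u hu => mem_orthogonalStabilizer.2 fun z hz => (L.mem_orthogonal _).2 fun x hx => ?_
  have hx' : u⁻¹ • x ∈ L := mem_orthogonalStabilizer.1 (inv_mem hu) x hx
  rw [← smul_inv_smul u x]
  exact (Unitary.inner_map_map u _ z).trans (Submodule.inner_right_of_mem_orthogonal hx' hz)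

theorem exists_unitary_smul_eq {L : Submodule ℝ E} {x y : E} (hx : x ∈ L) (hy : y ∈ L)
    (h : ‖x‖ = ‖y‖) : ∃ u : unitary (E →L[ℝ] E), u • x = y ∧ ∀ z ∈ Lᗮ, u • z = z := by
  refine ⟨Unitary.linearIsometryEquiv.symm (ℝ ∙ (x - y))ᗮ.reflection,
    Submodule.reflection_sub h, fun z hz => Submodule.reflection_mem_subspace_eq_self ?_⟩
  exact Submodule.mem_orthogonal_singleton_iff_inner_right.2
    (Submodule.inner_right_of_mem_orthogonal (L.sub_mem hx hy) hz)

theorem exists_orthogonalStabilizer_smul_eq {L : Submodule ℝ E} {x x' z z' : E} (hx : x ∈ L)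
    (hx' : x' ∈ L) (hz : z ∈ Lᗮ) (hz' : z' ∈ Lᗮ) (hxx' : ‖x‖ = ‖x'‖) (hzz' : ‖z‖ = ‖z'‖) :
    ∃ u : orthogonalStabilizer L, u • x = x' ∧ u • z = z' := by
  obtain ⟨u, hux, hu⟩ := exists_unitary_smul_eq hx hx' hxx'
  obtain ⟨v, hvz, hv⟩ := exists_unitary_smul_eq hz hz' hzz'
  rw [L.orthogonal_orthogonal] at hv
  have hu_mem : u ∈ orthogonalStabilizer L := by
    rw [← orthogonalStabilizer_orthogonal, mem_orthogonalStabilizer]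
    exact fun z hz => by rwa [hu z hz]
  have hv_mem : v ∈ orthogonalStabilizer L :=
    mem_orthogonalStabilizer.2 fun x hx => by rwa [hv x hx]
  refine ⟨⟨v * u, mul_mem hv_mem hu_mem⟩, ?_, ?_⟩
  · rw [Subgroup.mk_smul, mul_smul, hux, hv x' hx']
  · rw [Subgroup.mk_smul, mul_smul, hu z hz, hvz]

theorem smul_mem_orthogonal_iff_of_orthogonalStabilizer {L : Submodule ℝ E}
    (u : orthogonalStabilizer L) {x : E} : u • x ∈ Lᗮ ↔ x ∈ Lᗮ :=
  smul_mem_iff_of_orthogonalStabilizer (⟨u.1, (orthogonalStabilizer_orthogonal L).ge u.2⟩ :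
    orthogonalStabilizer Lᗮ)

theorem starProjection_smul {L : Submodule ℝ E} (u : orthogonalStabilizer L) (x : E) :
    L.starProjection (u • x) = u • L.starProjection x := by
  refine Submodule.eq_starProjection_of_mem_orthogonal' (z := u • Lᗮ.starProjection x)
    ((smul_mem_iff_of_orthogonalStabilizer u).2 (L.starProjection_apply_mem x))
    ((smul_mem_orthogonal_iff_of_orthogonalStabilizer u).2 (Lᗮ.starProjection_apply_mem x)) ?_
  rw [← smul_add, L.starProjection_add_starProjection_orthogonal]

theorem starProjection_orthogonal_smul {L : Submodule ℝ E} (u : orthogonalStabilizer L) (x : E) :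
    Lᗮ.starProjection (u • x) = u • Lᗮ.starProjection x :=
  starProjection_smul (⟨u.1, (orthogonalStabilizer_orthogonal L).ge u.2⟩ :
    orthogonalStabilizer Lᗮ) x

end OrthogonalStabilizer

section Gaussian

variable {E : Type*} [NormedAddCommGroup E] [InnerProductSpace ℝ E] [FiniteDimensional ℝ E]
  [MeasurableSpace E] [BorelSpace E]

theorem stdGaussian_submodule_eq_zero {V : Submodule ℝ E} (hV : V ≠ ⊤) :
    stdGaussian E (V : Set E) = 0 := by
  obtain ⟨v, hv, hv0⟩ : ∃ v ∈ Vᗮ, v ≠ 0 :=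
    Submodule.exists_mem_ne_zero_of_ne_bot (by rwa [Ne, Submodule.orthogonal_eq_bot_iff])
  set f : StrongDual ℝ E := innerSL ℝ v
  have hmap := IsGaussian.map_eq_gaussianReal (μ := stdGaussian E) f
  rw [variance_dual_stdGaussian] at hmap
  have hne : (‖f‖ ^ 2).toNNReal ≠ 0 := by
    rw [innerSL_apply_norm]
    simpa using hv0
  have : NullSingletonClass (gaussianReal (∫ x, f x ∂stdGaussian E) (‖f‖ ^ 2).toNNReal) :=
    nullSingletonClass_gaussianReal hne
  have h0 : (stdGaussian E).map f {0} = 0 := by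
    rw [hmap, measure_singleton]
  rw [Measure.map_apply f.measurable (measurableSet_singleton _)] at h0
  exact measure_mono_null (fun x hx => Submodule.inner_left_of_mem_orthogonal hx hv) h0

theorem ae_starProjection_ne_zero {L : Submodule ℝ E} (hL : L ≠ ⊥) :
    ∀ᵐ g ∂stdGaussian E, L.starProjection g ≠ 0 := by
  have h : Lᗮ ≠ ⊤ := by rwa [Ne, Submodule.orthogonal_eq_top_iff]
  refine measure_mono_null (fun g hg => ?_) (stdGaussian_submodule_eq_zero h)
  have hg0 : L.starProjection g = 0 := not_not.mp hg
  simpa [hg0] using L.sub_starProjection_mem_orthogonal g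

end Gaussian

section Biconic

variable {d : ℕ}

theorem IsBiconic.smul_mem_iff {M : Set (Euc d × Euc d)} (hM : IsBiconic M) {s t : ℝ} (hs : 0 < s)
    (ht : 0 < t) (x z : Euc d) : (s • x, t • z) ∈ M ↔ (x, z) ∈ M := by
  conv_lhs => rw [← hM.2 s t hs ht]
  exact (biscale_bijective hs ht).1.mem_set_image (a := (x, z))

theorem isBiconic_of_forall_smul_mem {M : Set (Euc d × Euc d)} (hM : MeasurableSet M)
    (h : ∀ s t : ℝ, 0 < s → 0 < t → ∀ x z, (x, z) ∈ M → (s • x, t • z) ∈ M) : IsBiconic M := by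
  refine ⟨hM, fun s t hs ht => Set.Subset.antisymm ?_ fun p hp => ?_⟩
  · rintro _ ⟨p, hp, rfl⟩
    exact h s t hs ht _ _ hp
  · refine ⟨(s⁻¹ • p.1, t⁻¹ • p.2), h _ _ (inv_pos.2 hs) (inv_pos.2 ht) _ _ hp, ?_⟩
    simp [smul_smul, hs.ne', ht.ne']

theorem IsBiconic.inter {M N : Set (Euc d × Euc d)} (hM : IsBiconic M) (hN : IsBiconic N) :
    IsBiconic (M ∩ N) :=
  @MeasurableSet.inter _ (biconicAlgebra d) _ _ hM hN

theorem IsBiconic.diff {M N : Set (Euc d × Euc d)} (hM : IsBiconic M) (hN : IsBiconic N) :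
    IsBiconic (M \ N) :=
  @MeasurableSet.diff _ (biconicAlgebra d) _ _ hM hN

theorem IsBiconic.compl {M : Set (Euc d × Euc d)} (hM : IsBiconic M) : IsBiconic Mᶜ :=
  @MeasurableSet.compl _ _ (biconicAlgebra d) hM

theorem isBiconic_zero : IsBiconic ({0} : Set (Euc d × Euc d)) := by
  refine isBiconic_of_forall_smul_mem (measurableSet_singleton _) fun s t _ _ x z h => ?_
  obtain ⟨rfl, rfl⟩ := Prod.mk.inj h
  simp

theorem biconicMeasure_eq_inter_add_sdiff (s : BiconicMeasure d) {M N : Set (Euc d × Euc d)}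
    (hM : IsBiconic M) (hN : IsBiconic N) : s M = s (M ∩ N) + s (M \ N) := by
  rw [← Set.sdiff_inter_self_eq_sdiff, Set.inter_comm N]
  exact (@VectorMeasure.of_add_of_sdiff _ (biconicAlgebra d) _ _ _ s _ _ _ (hM.inter hN) hM
    Set.inter_subset_left).symm

theorem biconicAlgebra_le_borel (d : ℕ) :
    biconicAlgebra d ≤ (inferInstance : MeasurableSpace (Euc d × Euc d)) :=
  fun _ hM => hM.1

/-- Normalization of both components to unit length. A biconic set is determined by the normalized
pairs it contains, so the quotient by positive rescalings is represented by such pairs. -/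
noncomputable def biNormalize (p : Euc d × Euc d) : Euc d × Euc d :=
  (NormedSpace.normalize p.1, NormedSpace.normalize p.2)

theorem exists_pos_normalize_eq_smul (x : Euc d) :
    ∃ s : ℝ, 0 < s ∧ NormedSpace.normalize x = s • x := by
  rcases eq_or_ne x 0 with rfl | hx
  · exact ⟨1, one_pos, by simp⟩
  · exact ⟨‖x‖⁻¹, inv_pos.2 (norm_pos_iff.2 hx), rfl⟩

theorem IsBiconic.biNormalize_mem_iff {M : Set (Euc d × Euc d)} (hM : IsBiconic M)
    (p : Euc d × Euc d) : biNormalize p ∈ M ↔ p ∈ M := by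
  obtain ⟨s, hs, hsp⟩ := exists_pos_normalize_eq_smul p.1
  obtain ⟨t, ht, htp⟩ := exists_pos_normalize_eq_smul p.2
  rw [biNormalize, hsp, htp, hM.smul_mem_iff hs ht]

theorem measurable_biNormalize :
    Measurable[biconicAlgebra d] (biNormalize : Euc d × Euc d → Euc d × Euc d) := by
  have hm : Measurable (biNormalize : Euc d × Euc d → Euc d × Euc d) := by
    unfold biNormalize NormedSpace.normalize
    fun_prop
  refine fun B hB => isBiconic_of_forall_smul_mem (hm hB) fun s t hs ht x z h => ?_
  simpa only [Set.mem_preimage, biNormalize, NormedSpace.normalize_smul_of_pos hs,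
    NormedSpace.normalize_smul_of_pos ht] using h

-- A shortcut: the default search first unfolds the coordinates of `Euc d` and times out.
noncomputable instance (L : Submodule ℝ (Euc d)) : SMul (orthogonalStabilizer L) (Euc d) :=
  (inferInstance : MulAction (orthogonalStabilizer L) (Euc d)).toSMul

theorem biNormalize_smul (u : unitary (Euc d →L[ℝ] Euc d)) (p : Euc d × Euc d) :
    biNormalize (u • p) = u • biNormalize p := by
  have key (x : Euc d) : NormedSpace.normalize (u • x) = u • NormedSpace.normalize x := by
    have hu : ‖u • x‖ = ‖x‖ := (Unitary.linearIsometryEquiv u).norm_map x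
    rw [NormedSpace.normalize, NormedSpace.normalize, hu, smul_comm]
  exact Prod.ext (key p.1) (key p.2)

instance (L : Submodule ℝ (Euc d)) :
    @MeasurableSMul₂ (orthogonalStabilizer L) (Euc d × Euc d) _ _ (biconicAlgebra d) := by
  refine @MeasurableSMul₂.mk _ _ _ _ (biconicAlgebra d) fun M hM => ?_
  have hpre : Function.uncurry (· • ·) ⁻¹' M =
      (fun q : orthogonalStabilizer L × (Euc d × Euc d) => q.1 • biNormalize q.2) ⁻¹' M := by
    ext ⟨u, p⟩
    exact (IsBiconic.biNormalize_mem_iff hM _).symm.trans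
      (iff_of_eq (congrArg (· ∈ M) (biNormalize_smul u.1 p)))
  rw [hpre]
  have hm : @Measurable _ _ (@Prod.instMeasurableSpace _ _ _ (biconicAlgebra d)) _
      fun q : orthogonalStabilizer L × (Euc d × Euc d) => (q.1, biNormalize q.2) :=
    @Measurable.prodMk _ _ _ _ _ (_) _ _ (@measurable_fst _ _ _ (biconicAlgebra d))
      (measurable_biNormalize.comp (@measurable_snd _ _ _ (biconicAlgebra d)))
  exact hm (measurable_smul hM.1)

/-- The components of a vector in a subspace and in its orthogonal complement. -/
noncomputable def orthogonalSplit (L : Submodule ℝ (Euc d)) (g : Euc d) : Euc d × Euc d :=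
  (L.starProjection g, Lᗮ.starProjection g)

theorem measurable_orthogonalSplit (L : Submodule ℝ (Euc d)) : Measurable (orthogonalSplit L) := by
  unfold orthogonalSplit
  fun_prop

theorem orthogonalSplit_smul {L : Submodule ℝ (Euc d)} (u : orthogonalStabilizer L) (g : Euc d) :
    orthogonalSplit L (u • g) = u • orthogonalSplit L g :=
  Prod.ext (starProjection_smul u g) (starProjection_orthogonal_smul u g)

/-- The pairs in `L × Lᗮ` neither of whose components vanishes, unless it has to. -/
def genericPairs (L : Submodule ℝ (Euc d)) : Set (Euc d × Euc d) :=
  {p | p.1 ∈ L ∧ p.2 ∈ Lᗮ ∧ (p.1 = 0 → L = ⊥) ∧ (p.2 = 0 → Lᗮ = ⊥)}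

theorem isBiconic_genericPairs (L : Submodule ℝ (Euc d)) : IsBiconic (genericPairs L) := by
  refine isBiconic_of_forall_smul_mem ?_ fun s t hs ht x z h =>
    ⟨L.smul_mem _ h.1, Lᗮ.smul_mem _ h.2.1,
      fun hx => h.2.2.1 ((smul_eq_zero_iff_right hs.ne').1 hx),
      fun hz => h.2.2.2 ((smul_eq_zero_iff_right ht.ne').1 hz)⟩
  refine (measurable_fst L.closed_of_finiteDimensional.measurableSet).inter
    ((measurable_snd Lᗮ.closed_of_finiteDimensional.measurableSet).inter (.inter ?_ ?_))
  · exact .imp (measurable_fst (measurableSet_singleton 0)) (.const _)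
  · exact .imp (measurable_snd (measurableSet_singleton 0)) (.const _)

theorem ae_orthogonalSplit_mem_genericPairs (L : Submodule ℝ (Euc d)) :
    ∀ᵐ g ∂stdGaussian (Euc d), orthogonalSplit L g ∈ genericPairs L := by
  have key (V : Submodule ℝ (Euc d)) :
      ∀ᵐ g ∂stdGaussian (Euc d), V.starProjection g = 0 → V = ⊥ := by
    by_cases hV : V = ⊥
    · exact .of_forall fun _ _ => hV
    · filter_upwards [ae_starProjection_ne_zero hV] with g hg h using absurd h hg
  filter_upwards [key L, key Lᗮ] with g hg hg'
  exact ⟨L.starProjection_apply_mem g, Lᗮ.starProjection_apply_mem g, hg, hg'⟩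

theorem exists_smul_mem_measurableAtom {L : Submodule ℝ (Euc d)} {p q : Euc d × Euc d}
    (hp : p ∈ genericPairs L) (hq : q ∈ genericPairs L) :
    ∃ u : orthogonalStabilizer L, u • p ∈ @measurableAtom _ (biconicAlgebra d) q := by
  have norm_eq {V : Submodule ℝ (Euc d)} {x y : Euc d} (hx : x ∈ V) (hy : y ∈ V)
      (hx0 : x = 0 → V = ⊥) (hy0 : y = 0 → V = ⊥) :
      ‖NormedSpace.normalize x‖ = ‖NormedSpace.normalize y‖ := by
    by_cases hV : V = ⊥
    · rw [hV, Submodule.mem_bot] at hx hy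
      rw [hx, hy]
    · rw [NormedSpace.norm_normalize (mt hx0 hV), NormedSpace.norm_normalize (mt hy0 hV)]
  obtain ⟨u, hu₁, hu₂⟩ := exists_orthogonalStabilizer_smul_eq
    (L.smul_mem ‖p.1‖⁻¹ hp.1) (L.smul_mem ‖q.1‖⁻¹ hq.1)
    (Lᗮ.smul_mem ‖p.2‖⁻¹ hp.2.1) (Lᗮ.smul_mem ‖q.2‖⁻¹ hq.2.1)
    (norm_eq hp.1 hq.1 hp.2.2.1 hq.2.2.1) (norm_eq hp.2.1 hq.2.1 hp.2.2.2 hq.2.2.2)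
  have hu : biNormalize (u • p) = biNormalize q :=
    (biNormalize_smul u.1 p).trans (Prod.ext hu₁ hu₂)
  refine ⟨u, Set.mem_iInter₂.2 fun N hq => Set.mem_iInter.2 fun hN => ?_⟩
  rwa [← IsBiconic.biNormalize_mem_iff hN, hu, IsBiconic.biNormalize_mem_iff hN]

/-- The law of the components of a standard Gaussian vector in `L` and `Lᗮ`, as a biconic
measure. -/
noncomputable def gaussianSplit (L : Submodule ℝ (Euc d)) : BiconicMeasure d :=
  ((stdGaussian (Euc d)).map (orthogonalSplit L)).toSignedMeasure.trim (biconicAlgebra_le_borel d)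

theorem gaussianSplit_apply (L : Submodule ℝ (Euc d)) {M : Set (Euc d × Euc d)}
    (hM : IsBiconic M) :
    gaussianSplit L M = (stdGaussian (Euc d)).real (orthogonalSplit L ⁻¹' M) := by
  rw [gaussianSplit, VectorMeasure.trim_measurableSet_eq _ hM,
    Measure.toSignedMeasure_apply_measurable hM.1,
    map_measureReal_apply (measurable_orthogonalSplit L) hM.1]

theorem gaussianSplit_genericPairs (L : Submodule ℝ (Euc d)) :
    gaussianSplit L (genericPairs L) = 1 := by
  rw [gaussianSplit_apply L (isBiconic_genericPairs L), measureReal_def,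
    (prob_compl_eq_zero_iff (measurable_orthogonalSplit L (isBiconic_genericPairs L).1)).1
      (ae_orthogonalSplit_mem_genericPairs L), ENNReal.toReal_one]

theorem gaussianSplit_inter_genericPairs (L : Submodule ℝ (Euc d)) {M : Set (Euc d × Euc d)}
    (hM : IsBiconic M) : gaussianSplit L (M ∩ genericPairs L) = gaussianSplit L M := by
  rw [gaussianSplit_apply L hM, gaussianSplit_apply L (hM.inter (isBiconic_genericPairs L))]
  refine measureReal_congr ?_
  filter_upwards [ae_orthogonalSplit_mem_genericPairs L] with g hg
  exact propext ⟨fun h => h.1, fun h => ⟨h, hg⟩⟩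

theorem isBiconic_preimage_smul {M : Set (Euc d × Euc d)} (hM : IsBiconic M)
    {L : Submodule ℝ (Euc d)} (u : orthogonalStabilizer L) : IsBiconic ((u • ·) ⁻¹' M) :=
  @measurable_const_smul _ _ _ (biconicAlgebra d) _ u M hM

theorem gaussianSplit_preimage_smul (L : Submodule ℝ (Euc d)) (u : orthogonalStabilizer L)
    {M : Set (Euc d × Euc d)} (hM : IsBiconic M) :
    gaussianSplit L ((u • ·) ⁻¹' M) = gaussianSplit L M := by
  rw [gaussianSplit_apply L hM, gaussianSplit_apply L (isBiconic_preimage_smul hM u)]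
  conv_rhs => rw [← stdGaussian_map (Unitary.linearIsometryEquiv u.1), map_measureReal_apply
    (LinearIsometryEquiv.continuous _).measurable (measurable_orthogonalSplit L hM.1)]
  congr 1
  ext g
  exact iff_of_eq (congrArg (· ∈ M) (orthogonalSplit_smul u g).symm)

theorem eq_mul_gaussianSplit_of_subset_genericPairs {L : Submodule ℝ (Euc d)}
    {s : BiconicMeasure d} {M : Set (Euc d × Euc d)}
    (hs : ∀ u : orthogonalStabilizer L, s ((u • ·) ⁻¹' M) = s M)
    (hM : IsBiconic M) (hML : M ⊆ genericPairs L) :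
    s M = s (genericPairs L) * gaussianSplit L M := by
  have h := signedMeasure_mul_eq_mul_of_smul_invariant (mα := biconicAlgebra d) hs
    (gaussianSplit_preimage_smul L · hM) hM (isBiconic_genericPairs L) hML
    (fun u p hp => ?_) fun p hp q hq => exists_smul_mem_measurableAtom hp hq
  · rwa [gaussianSplit_genericPairs, mul_one] at h
  · refine ⟨(smul_mem_iff_of_orthogonalStabilizer u).1 hp.1,
      (smul_mem_orthogonal_iff_of_orthogonalStabilizer u).1 hp.2.1, fun h => hp.2.2.1 ?_,
      fun h => hp.2.2.2 ?_⟩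
    · rw [Prod.smul_fst, h, smul_zero]
    · rw [Prod.smul_snd, h, smul_zero]

end Biconic

section PolyhedralCones

variable {d : ℕ}

theorem PolyCone.zero_mem (C : PolyCone d) : (0 : Euc d) ∈ C.carrier := by
  obtain ⟨_, m, a, rfl⟩ := C
  simp [PolyCone.carrier]

theorem PolyCone.add_mem {C : PolyCone d} {x y : Euc d} (hx : x ∈ C.carrier)
    (hy : y ∈ C.carrier) : x + y ∈ C.carrier := by
  obtain ⟨_, m, a, rfl⟩ := C
  intro i
  rw [inner_add_right]
  exact add_nonpos (hx i) (hy i)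

theorem PolyCone.smul_mem {C : PolyCone d} {x : Euc d} {t : ℝ} (ht : 0 ≤ t) (hx : x ∈ C.carrier) :
    t • x ∈ C.carrier := by
  obtain ⟨_, m, a, rfl⟩ := C
  intro i
  rw [real_inner_smul_right]
  exact mul_nonpos_of_nonneg_of_nonpos ht (hx i)

theorem PolyCone.convex (C : PolyCone d) : Convex ℝ C.carrier :=
  fun _ hx _ hy _ _ ha hb _ => add_mem (smul_mem ha hx) (smul_mem hb hy)

theorem PolyCone.isClosed (C : PolyCone d) : IsClosed C.carrier := by
  obtain ⟨_, m, a, rfl⟩ := C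
  simp only [PolyCone.carrier, Set.ofPred_forall]
  exact isClosed_iInter fun i => isClosed_le (by fun_prop) continuous_const

theorem polarCone_add_mem {C : Set (Euc d)} {z w : Euc d} (hz : z ∈ polarCone C)
    (hw : w ∈ polarCone C) : z + w ∈ polarCone C := fun x hx => by
  rw [inner_add_right]
  exact add_nonpos (hz x hx) (hw x hx)

theorem polarCone_smul_mem {C : Set (Euc d)} {z : Euc d} {t : ℝ} (ht : 0 ≤ t)
    (hz : z ∈ polarCone C) : t • z ∈ polarCone C := fun x hx => by
  rw [real_inner_smul_right]
  exact mul_nonpos_of_nonneg_of_nonpos ht (hz x hx)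

theorem convex_polarCone (C : Set (Euc d)) : Convex ℝ (polarCone C) :=
  fun _ hx _ hy _ _ ha hb _ =>
    polarCone_add_mem (polarCone_smul_mem ha hx) (polarCone_smul_mem hb hy)

theorem isClosed_polarCone (C : Set (Euc d)) : IsClosed (polarCone C) := by
  simp only [polarCone, Set.ofPred_forall]
  exact isClosed_biInter fun x _ => isClosed_le (by fun_prop) continuous_const

theorem isBiconic_biconicLift (C : PolyCone d) : IsBiconic (biconicLift C) := by
  refine isBiconic_of_forall_smul_mem ?_ fun s t hs ht x z h =>
    ⟨PolyCone.smul_mem hs.le h.1, polarCone_smul_mem ht.le h.2.1, ?_⟩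
  · exact (measurable_fst C.isClosed.measurableSet).inter
      ((measurable_snd (isClosed_polarCone C.carrier).measurableSet).inter
        (measurableSet_eq_fun (by fun_prop) (by fun_prop)))
  · simp only [real_inner_smul_left, real_inner_smul_right]
    rw [show inner ℝ x z = 0 from h.2.2, mul_zero, mul_zero]

theorem zero_mem_biconicLift (C : PolyCone d) : 0 ∈ biconicLift C :=
  ⟨C.zero_mem, fun x _ => by simp, by simp⟩

theorem mem_biconicLift_ofSubspace {L : Submodule ℝ (Euc d)} {p : Euc d × Euc d} :
    p ∈ biconicLift (PolyCone.ofSubspace L) ↔ p.1 ∈ L ∧ p.2 ∈ Lᗮ := by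
  refine ⟨fun ⟨hx, hz, _⟩ => ⟨hx, (L.mem_orthogonal _).2 fun u hu => le_antisymm (hz u hu) ?_⟩,
    fun ⟨hx, hz⟩ => ⟨hx, fun u hu => (Submodule.inner_right_of_mem_orthogonal hu hz).le,
      Submodule.inner_right_of_mem_orthogonal hx hz⟩⟩
  simpa using hz (-u) (L.neg_mem hu)

theorem norm_add_sub_left_le {E : Type*} [NormedAddCommGroup E] [InnerProductSpace ℝ E]
    {x z w : E} (hxz : inner ℝ x z = 0) (hwz : inner ℝ w z ≤ 0) : ‖x + z - x‖ ≤ ‖x + z - w‖ := by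
  have h := norm_add_sq_real z (x - w)
  rw [inner_sub_right, real_inner_comm x z, hxz, real_inner_comm w z] at h
  rw [add_sub_cancel_left, show x + z - w = z + (x - w) by abel]
  refine (sq_le_sq₀ (norm_nonneg _) (norm_nonneg _)).1 ?_
  nlinarith [sq_nonneg ‖x - w‖]

theorem nearestPt_add_of_mem_biconicLift {C : PolyCone d} {x z : Euc d}
    (h : (x, z) ∈ biconicLift C) :
    nearestPt C.carrier (x + z) = x :=
  (IsNearestPoint.eq_nearestPt C.isClosed C.convex
    ⟨h.1, fun w hw => norm_add_sub_left_le h.2.2 (h.2.1 w hw)⟩).symm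

theorem nearestPt_polarCone_add_of_mem_biconicLift {C : PolyCone d} {x z : Euc d}
    (h : (x, z) ∈ biconicLift C) :
    nearestPt (polarCone C.carrier) (x + z) = z := by
  refine (IsNearestPoint.eq_nearestPt (isClosed_polarCone _) (convex_polarCone _)
    ⟨h.2.1, fun w hw => ?_⟩).symm
  rw [add_comm x z]
  exact norm_add_sub_left_le ((real_inner_comm _ _).trans h.2.2)
    ((real_inner_comm _ _).trans_le (hw x h.1))

theorem inner_sub_nearestPt_le (C : PolyCone d) (g : Euc d) {w : Euc d}
    (hw : w ∈ C.carrier) :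
    inner ℝ (g - nearestPt C.carrier g) (w - nearestPt C.carrier g) ≤ 0 := by
  obtain ⟨hy, hmin⟩ := nearestPt_spec C.isClosed ⟨0, C.zero_mem⟩ g
  have : Nonempty C.carrier := ⟨⟨w, hw⟩⟩
  refine (norm_eq_iInf_iff_real_inner_le_zero C.convex hy).1 (le_antisymm ?_ ?_) w hw
  · exact le_ciInf fun w => hmin w w.2
  · exact ciInf_le (f := fun w : C.carrier => ‖g - w‖)
      ⟨0, by rintro _ ⟨w, rfl⟩; exact norm_nonneg _⟩ ⟨_, hy⟩

theorem nearestPt_sub_nearestPt_mem_biconicLift (C : PolyCone d) (g : Euc d) :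
    (nearestPt C.carrier g, g - nearestPt C.carrier g) ∈ biconicLift C := by
  have hy : nearestPt C.carrier g ∈ C.carrier := (nearestPt_spec C.isClosed ⟨0, C.zero_mem⟩ g).1
  have polar : g - nearestPt C.carrier g ∈ polarCone C.carrier := fun w hw => by
    simpa [real_inner_comm] using inner_sub_nearestPt_le C g (PolyCone.add_mem hw hy)
  refine ⟨hy, polar, le_antisymm (polar _ hy) ?_⟩
  simpa [real_inner_comm] using inner_sub_nearestPt_le C g C.zero_mem

theorem nearestPt_polarCone (C : PolyCone d) (g : Euc d) :
    nearestPt (polarCone C.carrier) g = g - nearestPt C.carrier g := by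
  simpa using nearestPt_polarCone_add_of_mem_biconicLift
    (nearestPt_sub_nearestPt_mem_biconicLift C g)

theorem nearestPt_mem_biconicLift (C : PolyCone d) (g : Euc d) :
    (nearestPt C.carrier g, nearestPt (polarCone C.carrier) g) ∈ biconicLift C := by
  rw [nearestPt_polarCone]
  exact nearestPt_sub_nearestPt_mem_biconicLift C g

end PolyhedralCones

section Faces

open Filter Topology

theorem eventually_add_smul_mem {E : Type*} [AddCommGroup E] [Module ℝ E] [TopologicalSpace E]
    [ContinuousAdd E] [ContinuousSMul ℝ E] {L : Submodule ℝ E} {C : Set E} {x v : E}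
    (hx : x ∈ L) (hC : C ∈ 𝓝[L] x) (hv : v ∈ L) : ∀ᶠ t in 𝓝[>] (0 : ℝ), x + t • v ∈ C := by
  have hcont : Tendsto (fun t : ℝ => x + t • v) (𝓝[>] 0) (𝓝 x) := by
    have : Continuous fun t : ℝ => x + t • v := by fun_prop
    simpa using (this.tendsto 0).mono_left nhdsWithin_le_nhds
  exact tendsto_nhdsWithin_iff.2 ⟨hcont, .of_forall fun t => L.add_mem hx (L.smul_mem t hv)⟩ hC

theorem submodule_le_of_mem_nhdsWithin {E : Type*} [AddCommGroup E] [Module ℝ E]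
    [TopologicalSpace E] [ContinuousAdd E] [ContinuousSMul ℝ E] {V W : Submodule ℝ E} {x : E}
    (hx : x ∈ V) (hW : (W : Set E) ∈ 𝓝[V] x) : V ≤ W := by
  intro v hv
  obtain ⟨t, ht, ht0⟩ := ((eventually_add_smul_mem hx hW hv).and self_mem_nhdsWithin).exists
  have htv := W.sub_mem ht (mem_of_mem_nhdsWithin hx hW)
  rw [add_sub_cancel_left] at htv
  exact (W.smul_mem_iff (ne_of_gt ht0)).1 htv

variable {d : ℕ}

theorem mem_interiorIn {L : Submodule ℝ (Euc d)} {C : Set (Euc d)} {x : Euc d} :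
    x ∈ interiorIn L C ↔ x ∈ L ∧ C ∈ 𝓝[L] x := by
  simp only [interiorIn, Set.mem_image, mem_interior_iff_mem_nhds, Subtype.exists,
    exists_and_right, exists_eq_right]
  exact ⟨fun ⟨hx, h⟩ => ⟨hx, preimage_coe_mem_nhds_subtype.1 h⟩,
    fun ⟨hx, h⟩ => ⟨hx, preimage_coe_mem_nhds_subtype.2 h⟩⟩

theorem interiorIn_subset (L : Submodule ℝ (Euc d)) (C : Set (Euc d)) : interiorIn L C ⊆ C :=
  fun _ hx => mem_of_mem_nhdsWithin (mem_interiorIn.1 hx).1 (mem_interiorIn.1 hx).2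

theorem measurableSet_interiorIn (L : Submodule ℝ (Euc d)) (C : Set (Euc d)) :
    MeasurableSet (interiorIn L C) :=
  (MeasurableEmbedding.subtype_coe L.closed_of_finiteDimensional.measurableSet
    ).measurableSet_image.2 isOpen_interior.measurableSet

theorem smul_mem_interiorIn {L : Submodule ℝ (Euc d)} {C : PolyCone d} {x : Euc d} {s : ℝ}
    (hs : 0 < s) (hx : x ∈ interiorIn L C.carrier) : s • x ∈ interiorIn L C.carrier := by
  obtain ⟨hxL, hxC⟩ := mem_interiorIn.1 hx
  have hcont : Tendsto (fun y : Euc d => s⁻¹ • y) (𝓝 (s • x)) (𝓝 x) := by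
    simpa [smul_smul, hs.ne'] using (continuous_const_smul s⁻¹).tendsto (s • x)
  have hscale : Tendsto (fun y : Euc d => s⁻¹ • y) (𝓝[L] (s • x)) (𝓝[L] x) :=
    tendsto_nhdsWithin_iff.2 ⟨hcont.mono_left nhdsWithin_le_nhds,
      eventually_nhdsWithin_of_forall fun y hy => L.smul_mem _ hy⟩
  refine mem_interiorIn.2 ⟨L.smul_mem s hxL, mem_of_superset (hscale hxC) fun y hy => ?_⟩
  simpa [smul_smul, hs.ne'] using PolyCone.smul_mem hs.le hy

theorem mem_orthogonal_of_mem_interiorIn {L : Submodule ℝ (Euc d)} {C : Set (Euc d)} {x z : Euc d}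
    (hx : x ∈ interiorIn L C) (hz : z ∈ polarCone C) (hxz : inner ℝ x z = 0) : z ∈ Lᗮ := by
  have inner_nonpos : ∀ v ∈ L, inner ℝ v z ≤ 0 := fun v hv => by
    obtain ⟨hxL, hxC⟩ := mem_interiorIn.1 hx
    obtain ⟨t, ht, ht0⟩ := ((eventually_add_smul_mem hxL hxC hv).and self_mem_nhdsWithin).exists
    have h := hz _ ht
    rw [inner_add_left, hxz, real_inner_smul_left, zero_add] at h
    exact nonpos_of_mul_nonpos_right h ht0
  refine (L.mem_orthogonal _).2 fun v hv => le_antisymm (inner_nonpos v hv) ?_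
  simpa using inner_nonpos (-v) (L.neg_mem hv)

theorem le_of_mem_interiorIn {C : Set (Euc d)} {L L' : Submodule ℝ (Euc d)} {k k' : ℕ}
    (hL : L ∈ faceSpans C k) (hL' : L' ∈ faceSpans C k') {x : Euc d} (hx : x ∈ interiorIn L C)
    (hx' : x ∈ interiorIn L' C) : L' ≤ L := by
  obtain ⟨F, ⟨w, hw, rfl⟩, rfl, -⟩ := hL
  obtain ⟨F', ⟨w', -, rfl⟩, rfl, -⟩ := hL'
  have hxw : inner ℝ x w = 0 := by
    have hle : Submodule.span ℝ {x | x ∈ C ∧ inner ℝ x w = 0} ≤ (ℝ ∙ w)ᗮ :=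
      Submodule.span_le.2 fun y hy => Submodule.mem_orthogonal_singleton_iff_inner_left.2 hy.2
    exact Submodule.mem_orthogonal_singleton_iff_inner_left.1 (hle (mem_interiorIn.1 hx).1)
  have hwL' := mem_orthogonal_of_mem_interiorIn hx' hw hxw
  exact Submodule.span_le.2 fun y hy => Submodule.subset_span
    ⟨hy.1, Submodule.inner_right_of_mem_orthogonal (Submodule.subset_span hy) hwL'⟩

theorem eq_of_mem_interiorIn {C : Set (Euc d)} {L L' : Submodule ℝ (Euc d)} {k k' : ℕ}
    (hL : L ∈ faceSpans C k) (hL' : L' ∈ faceSpans C k') {x : Euc d} (hx : x ∈ interiorIn L C)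
    (hx' : x ∈ interiorIn L' C) : L = L' :=
  le_antisymm (le_of_mem_interiorIn hL' hL hx' hx) (le_of_mem_interiorIn hL hL' hx hx')

/-- The subspace on which the constraints `⟪a i, ·⟫ ≤ 0` active at `x` hold with equality. For `x`
in the cone cut out by the constraints, it is the span of the smallest face containing `x`. -/
noncomputable def activeSubspace {ι : Type*} (a : ι → Euc d) (x : Euc d) : Submodule ℝ (Euc d) :=
  ⨅ i ∈ {i | inner ℝ (a i) x = 0}, (ℝ ∙ a i)ᗮ

theorem mem_activeSubspace {ι : Type*} {a : ι → Euc d} {x y : Euc d} :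
    y ∈ activeSubspace a x ↔ ∀ i, inner ℝ (a i) x = 0 → inner ℝ (a i) y = 0 := by
  simp only [activeSubspace, Submodule.mem_iInf, Set.mem_ofPred_eq,
    Submodule.mem_orthogonal_singleton_iff_inner_right]

theorem mem_interiorIn_activeSubspace {ι : Type*} [Finite ι] {a : ι → Euc d} {x : Euc d}
    (hx : ∀ i, inner ℝ (a i) x ≤ 0) :
    x ∈ interiorIn (activeSubspace a x) {y | ∀ i, inner ℝ (a i) y ≤ 0} := by
  have inactive : ∀ᶠ y in 𝓝 x, ∀ i, inner ℝ (a i) x ≠ 0 → inner ℝ (a i) y < 0 := by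
    refine eventually_all.2 fun i => ?_
    by_cases hi : inner ℝ (a i) x = 0
    · exact .of_forall fun y h => absurd hi h
    · have hcont : Continuous fun y => inner ℝ (a i) y := by fun_prop
      filter_upwards [(hcont.tendsto x).eventually_lt_const ((hx i).lt_of_ne hi)]
        with y hy _ using hy
  refine mem_interiorIn.2 ⟨mem_activeSubspace.2 fun _ => id, ?_⟩
  filter_upwards [self_mem_nhdsWithin, mem_nhdsWithin_of_mem_nhds inactive] with y hyV hy i
  by_cases hi : inner ℝ (a i) x = 0
  · exact (mem_activeSubspace.1 hyV i hi).le
  · exact (hy i hi).le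

/-- The face is exposed by the sum of the active normals. -/
theorem isConeFace_inter_activeSubspace {ι : Type*} [Finite ι] (a : ι → Euc d) (x : Euc d) :
    IsConeFace {y | ∀ i, inner ℝ (a i) y ≤ 0}
      ({y | ∀ i, inner ℝ (a i) y ≤ 0} ∩ activeSubspace a x) := by
  classical
  have := Fintype.ofFinite ι
  have inner_sum_active (y : Euc d) :
      inner ℝ y (∑ i with inner ℝ (a i) x = 0, a i) =
        ∑ i with inner ℝ (a i) x = 0, inner ℝ (a i) y := by
    rw [inner_sum]
    exact Finset.sum_congr rfl fun i _ => real_inner_comm _ _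
  refine ⟨∑ i with inner ℝ (a i) x = 0, a i, fun y hy => ?_, Set.ext fun y =>
    and_congr_right fun hy => ?_⟩
  · rw [inner_sum_active]
    exact Finset.sum_nonpos fun i _ => hy i
  · rw [inner_sum_active, Finset.sum_eq_zero_iff_of_nonpos fun i _ => hy i, SetLike.mem_coe,
      mem_activeSubspace]
    simp only [Finset.mem_filter_univ]

theorem activeSubspace_mem_faceSpans {ι : Type*} [Finite ι] {a : ι → Euc d} {x : Euc d}
    (hx : ∀ i, inner ℝ (a i) x ≤ 0) :
    activeSubspace a x ∈
      faceSpans {y | ∀ i, inner ℝ (a i) y ≤ 0} (Module.finrank ℝ (activeSubspace a x)) := by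
  refine ⟨_, isConeFace_inter_activeSubspace a x, le_antisymm ?_ ?_, rfl⟩
  · obtain ⟨hxV, hxC⟩ := mem_interiorIn.1 (mem_interiorIn_activeSubspace hx)
    exact submodule_le_of_mem_nhdsWithin hxV
      (mem_of_superset (inter_mem hxC self_mem_nhdsWithin) Submodule.subset_span)
  · exact Submodule.span_le.2 Set.inter_subset_right

theorem PolyCone.exists_mem_faceSpans_mem_interiorIn (C : PolyCone d) {x : Euc d}
    (hx : x ∈ C.carrier) :
    ∃ L : Submodule ℝ (Euc d), L ∈ faceSpans C.carrier (Module.finrank ℝ L) ∧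
      x ∈ interiorIn L C.carrier := by
  obtain ⟨_, m, a, rfl⟩ := C
  exact ⟨activeSubspace a x, activeSubspace_mem_faceSpans hx, mem_interiorIn_activeSubspace hx⟩

theorem PolyCone.finite_setOf_faceSpans_nonempty_interiorIn (C : PolyCone d) :
    {L : Submodule ℝ (Euc d) | L ∈ faceSpans C.carrier (Module.finrank ℝ L) ∧
      (interiorIn L C.carrier).Nonempty}.Finite := by
  obtain ⟨_, m, a, rfl⟩ := C
  refine (Set.finite_range fun I : Set (Fin m) => ⨅ i ∈ I, (ℝ ∙ a i)ᗮ).subset ?_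
  rintro L ⟨hL, x, hx⟩
  have hxC := interiorIn_subset L _ hx
  exact ⟨{i | inner ℝ (a i) x = 0}, eq_of_mem_interiorIn (activeSubspace_mem_faceSpans hxC) hL
    (mem_interiorIn_activeSubspace hxC) hx⟩

/-- The spans of the faces of `C`. Requiring a nonempty relative interior discards none of
them, and makes the spans correspond to the sets of constraints active at some point of `C`. -/
noncomputable def PolyCone.faceSubspaces (C : PolyCone d) : Finset (Submodule ℝ (Euc d)) :=
  C.finite_setOf_faceSpans_nonempty_interiorIn.toFinset

theorem PolyCone.mem_faceSubspaces {C : PolyCone d} {L : Submodule ℝ (Euc d)} :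
    L ∈ C.faceSubspaces ↔ L ∈ faceSpans C.carrier (Module.finrank ℝ L) ∧
      (interiorIn L C.carrier).Nonempty :=
  Set.Finite.mem_toFinset _

theorem PolyCone.exists_mem_faceSubspaces_mem_interiorIn (C : PolyCone d) {x : Euc d}
    (hx : x ∈ C.carrier) : ∃ L ∈ C.faceSubspaces, x ∈ interiorIn L C.carrier := by
  obtain ⟨L, hL, hxL⟩ := C.exists_mem_faceSpans_mem_interiorIn hx
  exact ⟨L, mem_faceSubspaces.2 ⟨hL, x, hxL⟩, hxL⟩

theorem PolyCone.mem_skeleton {C : PolyCone d} {k : ℕ} {x : Euc d} :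
    x ∈ skeleton C.carrier k ↔
      ∃ L ∈ C.faceSubspaces, Module.finrank ℝ L = k ∧ x ∈ interiorIn L C.carrier := by
  simp only [skeleton, Set.mem_iUnion₂, exists_prop, mem_faceSubspaces]
  constructor
  · rintro ⟨L, ⟨F, hF, hL, rfl⟩, hx⟩
    exact ⟨L, ⟨⟨F, hF, hL, rfl⟩, x, hx⟩, rfl, hx⟩
  · rintro ⟨L, ⟨hL, -⟩, rfl, hx⟩
    exact ⟨L, hL, hx⟩

/-- The pairs whose first component is interior to `C` relative to `L`. -/
def interiorPairs (L : Submodule ℝ (Euc d)) (C : PolyCone d) : Set (Euc d × Euc d) :=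
  {p | p.1 ∈ interiorIn L C.carrier}

theorem isBiconic_interiorPairs (L : Submodule ℝ (Euc d)) (C : PolyCone d) :
    IsBiconic (interiorPairs L C) :=
  isBiconic_of_forall_smul_mem (measurable_fst (measurableSet_interiorIn L C.carrier))
    fun _ _ hs _ _ _ h => smul_mem_interiorIn hs h

theorem pairwiseDisjoint_interiorPairs (C : PolyCone d) :
    (C.faceSubspaces : Set (Submodule ℝ (Euc d))).PairwiseDisjoint fun L => interiorPairs L C :=
  fun _ hL _ hL' hne => Set.disjoint_left.2 fun _ hp hp' => hne <|
    eq_of_mem_interiorIn (PolyCone.mem_faceSubspaces.1 hL).1 (PolyCone.mem_faceSubspaces.1 hL').1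
      hp hp'

theorem biUnion_inter_interiorPairs {C : PolyCone d} {M : Set (Euc d × Euc d)}
    (hMC : M ⊆ biconicLift C) : ⋃ L ∈ C.faceSubspaces, M ∩ interiorPairs L C = M := by
  refine Set.Subset.antisymm (Set.iUnion₂_subset fun L _ => Set.inter_subset_left) fun p hp => ?_
  obtain ⟨L, hL, hpL⟩ := C.exists_mem_faceSubspaces_mem_interiorIn (hMC hp).1
  exact Set.mem_biUnion hL ⟨hp, hpL⟩

theorem inter_interiorPairs_subset {C : PolyCone d} {L : Submodule ℝ (Euc d)}
    {M : Set (Euc d × Euc d)} (hMC : M ⊆ biconicLift C) :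
    M ∩ interiorPairs L C ⊆ biconicLift (PolyCone.ofSubspace L) := fun _ hp =>
  mem_biconicLift_ofSubspace.2 ⟨(mem_interiorIn.1 hp.2).1,
    mem_orthogonal_of_mem_interiorIn hp.2 (hMC hp.1).2.1 (hMC hp.1).2.2⟩

end Faces

section SupportMeasures

variable {d : ℕ}

theorem orthogonalSplit_nearestPt_of_mem_interiorIn {C : PolyCone d} {L : Submodule ℝ (Euc d)}
    {g : Euc d} (hg : nearestPt C.carrier g ∈ interiorIn L C.carrier) :
    orthogonalSplit L g = (nearestPt C.carrier g, nearestPt (polarCone C.carrier) g) := by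
  obtain ⟨-, hz, hxz⟩ := nearestPt_mem_biconicLift C g
  have hproj : L.starProjection g = nearestPt C.carrier g :=
    L.eq_starProjection_of_mem_orthogonal (mem_interiorIn.1 hg).1
      (nearestPt_polarCone C g ▸ mem_orthogonal_of_mem_interiorIn hg hz hxz)
  exact Prod.ext hproj <| by
    rw [orthogonalSplit, L.starProjection_orthogonal_val, hproj, nearestPt_polarCone]

theorem orthogonalSplit_mem_iff {C : PolyCone d} {L : Submodule ℝ (Euc d)}
    {M : Set (Euc d × Euc d)} (hMC : M ⊆ biconicLift C) (g : Euc d) :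
    orthogonalSplit L g ∈ M ∩ interiorPairs L C ↔
      nearestPt C.carrier g ∈ interiorIn L C.carrier ∧
        (nearestPt C.carrier g, nearestPt (polarCone C.carrier) g) ∈ M := by
  refine ⟨fun ⟨hM, hint⟩ => ?_, fun ⟨hint, hM⟩ => ?_⟩
  · have hx := nearestPt_add_of_mem_biconicLift (hMC hM)
    rw [L.starProjection_add_starProjection_orthogonal] at hx
    have hint' : nearestPt C.carrier g ∈ interiorIn L C.carrier := hx ▸ hint
    exact ⟨hint', orthogonalSplit_nearestPt_of_mem_interiorIn hint' ▸ hM⟩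
  · rw [orthogonalSplit_nearestPt_of_mem_interiorIn hint]
    exact ⟨hM, hint⟩

theorem supportMeasure_eq_sum {C : PolyCone d} {M : Set (Euc d × Euc d)} (hM : IsBiconic M)
    (hMC : M ⊆ biconicLift C) (k : ℕ) :
    supportMeasure k C M =
      ∑ L ∈ C.faceSubspaces with Module.finrank ℝ (L : Submodule ℝ (Euc d)) = k,
        gaussianSplit L (M ∩ interiorPairs L C) := by
  have hM' (L : Submodule ℝ (Euc d)) := hM.inter (isBiconic_interiorPairs L C)
  simp only [gaussianSplit_apply _ (hM' _)]
  rw [← measureReal_biUnion_finset (fun L hL L' hL' hne => ?_)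
    fun L _ => measurable_orthogonalSplit L (hM' L).1]
  · unfold supportMeasure
    congr 1
    ext g
    simp only [PolyCone.mem_skeleton, Set.mem_iUnion₂, Finset.mem_filter, Set.mem_preimage,
      orthogonalSplit_mem_iff hMC, exists_prop, Set.mem_ofPred_eq]
    grind
  · refine Set.disjoint_left.2 fun g hg hg' => hne ?_
    exact eq_of_mem_interiorIn (PolyCone.mem_faceSubspaces.1 (Finset.mem_filter.1 hL).1).1
      (PolyCone.mem_faceSubspaces.1 (Finset.mem_filter.1 hL').1).1
      ((orthogonalSplit_mem_iff hMC g).1 hg).1 ((orthogonalSplit_mem_iff hMC g).1 hg').1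

theorem supportMeasure_inter_sdiff [NeZero d] (k : ℕ) (C : PolyCone d)
    (M : Set (Euc d × Euc d)) :
    supportMeasure k C ((M ∩ biconicLift C) \ {0}) = supportMeasure k C M := by
  refine measureReal_congr ?_
  have ae_ne_zero : ∀ᵐ g ∂stdGaussian (Euc d), g ≠ 0 := by
    simpa [Submodule.starProjection_top] using
      ae_starProjection_ne_zero (E := Euc d) (L := ⊤) top_ne_bot
  filter_upwards [ae_ne_zero] with g hg
  refine propext ⟨fun h => ⟨h.1, h.2.1.1⟩, fun h => ⟨h.1, ⟨h.2, nearestPt_mem_biconicLift C g⟩,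
    fun h0 => hg ?_⟩⟩
  obtain ⟨hx, hz⟩ := Prod.mk.inj h0
  rwa [nearestPt_polarCone, hx, sub_zero] at hz

theorem genericPairs_subset_biconicLift (L : Submodule ℝ (Euc d)) :
    genericPairs L ⊆ biconicLift (PolyCone.ofSubspace L) :=
  fun _ h => mem_biconicLift_ofSubspace.2 ⟨h.1, h.2.1⟩

theorem zero_notMem_genericPairs [NeZero d] (L : Submodule ℝ (Euc d)) : 0 ∉ genericPairs L := by
  rintro ⟨-, -, hL, hL'⟩
  have h : (⊥ : Submodule ℝ (Euc d))ᗮ = ⊥ := hL rfl ▸ hL' rfl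
  exact top_ne_bot (Submodule.bot_orthogonal_eq_top.symm.trans h)

theorem mem_genericPairs_bot_or_top {L : Submodule ℝ (Euc d)} {p : Euc d × Euc d}
    (hp : p ∈ biconicLift (PolyCone.ofSubspace L)) (hp0 : p ≠ 0) (hpL : p ∉ genericPairs L) :
    p ∈ genericPairs ⊥ ∨ p ∈ genericPairs ⊤ := by
  obtain ⟨hx, hz⟩ := mem_biconicLift_ofSubspace.1 hp
  by_cases hx0 : p.1 = 0
  · exact .inl ⟨hx0, by simp, fun _ => rfl, fun hz0 => absurd (Prod.ext hx0 hz0) hp0⟩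
  · have hz0 : p.2 = 0 := by
      by_contra hz0
      exact hpL ⟨hx, hz, fun h => absurd h hx0, fun h => absurd h hz0⟩
    exact .inr ⟨Submodule.mem_top, by simp [hz0], fun h => absurd h hx0,
      fun _ => Submodule.top_orthogonal_eq_bot⟩

theorem gaussianSplit_eq_zero_of_subset_biconicLift {L L' : Submodule ℝ (Euc d)} (hne : L ≠ L')
    {M : Set (Euc d × Euc d)} (hM : IsBiconic M)
    (hML : M ⊆ biconicLift (PolyCone.ofSubspace L)) : gaussianSplit L' M = 0 := by
  let V : Submodule ℝ (Euc d) :=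
    LinearMap.eqLocus L.starProjection.toLinearMap L'.starProjection.toLinearMap
  have hV : V ≠ ⊤ := fun h => hne <| Submodule.starProjection_inj.1 <|
    ContinuousLinearMap.ext fun g => (h ▸ Submodule.mem_top : g ∈ V)
  rw [gaussianSplit_apply L' hM, measureReal_def,
    measure_mono_null (fun g hg => ?_) (stdGaussian_submodule_eq_zero hV), ENNReal.toReal_zero]
  obtain ⟨hx, hz⟩ := mem_biconicLift_ofSubspace.1 (hML hg)
  refine L.eq_starProjection_of_mem_orthogonal hx ?_
  rwa [orthogonalSplit, L'.starProjection_orthogonal_val] at hz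

end SupportMeasures

section Characterization

variable {d : ℕ}

theorem PolyCone.map_ofSubspace (Q : Euc d ≃ₗᵢ[ℝ] Euc d) (L : Submodule ℝ (Euc d)) :
    (PolyCone.ofSubspace L).map Q =
      PolyCone.ofSubspace (L.map (Q.toLinearEquiv : Euc d →ₗ[ℝ] Euc d)) :=
  Subtype.ext rfl

theorem exists_submodule_finrank_eq {k : ℕ} (hk : k ≤ d) :
    ∃ L : Submodule ℝ (Euc d), Module.finrank ℝ L = k := by
  obtain ⟨f, hf⟩ := exists_linearIndependent_of_le_finrank (R := ℝ) (M := Euc d) (n := k)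
    (by simpa)
  exact ⟨Submodule.span ℝ (Set.range f), by simpa using finrank_span_eq_card hf⟩

theorem exists_linearIsometryEquiv_map_eq {L L' : Submodule ℝ (Euc d)}
    (h : Module.finrank ℝ L = Module.finrank ℝ L') :
    ∃ Q : Euc d ≃ₗᵢ[ℝ] Euc d, L.map (Q.toLinearEquiv : Euc d →ₗ[ℝ] Euc d) = L' := by
  let e : L ≃ₗᵢ[ℝ] L' :=
    (stdOrthonormalBasis ℝ L).equiv (stdOrthonormalBasis ℝ L') (finCongr h)
  let f : Euc d →ₗᵢ[ℝ] Euc d := (L'.subtypeₗᵢ.comp e.toLinearIsometry).extend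
  refine ⟨f.toLinearIsometryEquiv rfl, Submodule.eq_of_le_of_finrank_eq ?_ ?_⟩
  · rintro _ ⟨x, hx, rfl⟩
    have hf : f x = e ⟨x, hx⟩ :=
      (L'.subtypeₗᵢ.comp e.toLinearIsometry).extend_apply ⟨x, hx⟩
    exact hf.symm ▸ (e ⟨x, hx⟩).2
  · rw [LinearEquiv.finrank_map_eq, h]

theorem biRotate_compl_zero (Q : Euc d ≃ₗᵢ[ℝ] Euc d) : biRotate Q {0}ᶜ = {0}ᶜ := by
  have hQ : Function.Bijective fun p : Euc d × Euc d => (Q p.1, Q p.2) :=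
    Q.bijective.prodMap Q.bijective
  rw [biRotate, Set.image_compl_eq hQ, Set.image_singleton]
  simp

/-- The biconic set functions of the characterization theorem: concentrated on the biconic lift,
invariant under rotations, and local. Invariance is only asked on linear subspaces, as locality
reduces every cone to these. -/
structure IsLocalInvariant (ψ : PolyCone d → BiconicMeasure d) : Prop where
  concentrated : ∀ (C : PolyCone d) (M : Set (Euc d × Euc d)), IsBiconic M →
    ψ C M = ψ C (M ∩ biconicLift C)
  invariant : ∀ (Q : Euc d ≃ₗᵢ[ℝ] Euc d) (L : Submodule ℝ (Euc d)) (M : Set (Euc d × Euc d)),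
    IsBiconic M →
      ψ ((PolyCone.ofSubspace L).map Q) (biRotate Q M) = ψ (PolyCone.ofSubspace L) M
  local_on_lift : ∀ (C D : PolyCone d) (M : Set (Euc d × Euc d)), IsBiconic M →
    biconicLift C ∩ M = biconicLift D ∩ M → ψ C M = ψ D M

namespace IsLocalInvariant

variable {ψ : PolyCone d → BiconicMeasure d} {L L' : Submodule ℝ (Euc d)} {C D : PolyCone d}
  {M : Set (Euc d × Euc d)}

theorem congr (hψ : IsLocalInvariant ψ) (hM : IsBiconic M) (hC : M ⊆ biconicLift C)
    (hD : M ⊆ biconicLift D) : ψ C M = ψ D M :=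
  hψ.local_on_lift C D M hM <| by rw [Set.inter_eq_right.2 hC, Set.inter_eq_right.2 hD]

theorem apply_preimage_smul (hψ : IsLocalInvariant ψ) (u : orthogonalStabilizer L)
    (hM : IsBiconic M) :
    ψ (PolyCone.ofSubspace L) ((u • ·) ⁻¹' M) = ψ (PolyCone.ofSubspace L) M := by
  have hL : L.map ((Unitary.linearIsometryEquiv u.1).toLinearEquiv : Euc d →ₗ[ℝ] Euc d) = L := u.2
  have hM' : biRotate (Unitary.linearIsometryEquiv u.1) ((u • ·) ⁻¹' M) = M :=
    Set.image_preimage_eq M (MulAction.surjective u)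
  have h := hψ.invariant (Unitary.linearIsometryEquiv u.1) L _ (isBiconic_preimage_smul hM u)
  rwa [PolyCone.map_ofSubspace, hL, hM', eq_comm] at h

theorem ofSubspace_apply_of_subset_genericPairs (hψ : IsLocalInvariant ψ) (hM : IsBiconic M)
    (hML : M ⊆ genericPairs L) :
    ψ (PolyCone.ofSubspace L) M =
      ψ (PolyCone.ofSubspace L) (genericPairs L) * gaussianSplit L M :=
  eq_mul_gaussianSplit_of_subset_genericPairs (hψ.apply_preimage_smul · hM) hM hML

theorem ofSubspace_apply_compl_zero_congr (hψ : IsLocalInvariant ψ)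
    (h : Module.finrank ℝ L = Module.finrank ℝ L') :
    ψ (PolyCone.ofSubspace L) {0}ᶜ = ψ (PolyCone.ofSubspace L') {0}ᶜ := by
  obtain ⟨Q, rfl⟩ := exists_linearIsometryEquiv_map_eq h
  rw [← PolyCone.map_ofSubspace, ← hψ.invariant Q L _ isBiconic_zero.compl, biRotate_compl_zero]

theorem ofSubspace_apply_eq_zero (hψ : IsLocalInvariant ψ) (hM : IsBiconic M)
    (hML : M ⊆ biconicLift (PolyCone.ofSubspace L)) (hML' : M ⊆ genericPairs L')
    (hdisj : Disjoint M (genericPairs L)) : ψ (PolyCone.ofSubspace L) M = 0 := by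
  rcases eq_or_ne L L' with rfl | hne
  · rw [disjoint_self.1 (hdisj.mono_right hML'), Set.bot_eq_empty, VectorMeasure.empty]
  · rw [hψ.congr hM hML (hML'.trans (genericPairs_subset_biconicLift L')),
      hψ.ofSubspace_apply_of_subset_genericPairs hM hML',
      gaussianSplit_eq_zero_of_subset_biconicLift hne hM hML, mul_zero]

theorem ofSubspace_apply_inter_genericPairs (hψ : IsLocalInvariant ψ) (hM : IsBiconic M)
    (hML : M ⊆ biconicLift (PolyCone.ofSubspace L)) (h0 : 0 ∉ M) :
    ψ (PolyCone.ofSubspace L) (M ∩ genericPairs L) = ψ (PolyCone.ofSubspace L) M := by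
  have hN := hM.diff (isBiconic_genericPairs L)
  have hNL : M \ genericPairs L ⊆ biconicLift (PolyCone.ofSubspace L) :=
    Set.sdiff_subset.trans hML
  have hdisj : Disjoint (M \ genericPairs L) (genericPairs L) := Set.disjoint_sdiff_left
  have hbot : ψ (PolyCone.ofSubspace L) ((M \ genericPairs L) ∩ genericPairs ⊥) = 0 :=
    hψ.ofSubspace_apply_eq_zero (hN.inter (isBiconic_genericPairs ⊥))
      (Set.inter_subset_left.trans hNL) Set.inter_subset_right
      (hdisj.mono_left Set.inter_subset_left)
  have htop : ψ (PolyCone.ofSubspace L) ((M \ genericPairs L) \ genericPairs ⊥) = 0 :=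
    hψ.ofSubspace_apply_eq_zero (hN.diff (isBiconic_genericPairs ⊥))
      (Set.sdiff_subset.trans hNL)
      (fun p hp => (mem_genericPairs_bot_or_top (hML hp.1.1) (fun h => h0 (h ▸ hp.1.1))
        hp.1.2).resolve_left hp.2)
      (hdisj.mono_left Set.sdiff_subset)
  rw [biconicMeasure_eq_inter_add_sdiff (ψ (PolyCone.ofSubspace L)) hM (isBiconic_genericPairs L),
    biconicMeasure_eq_inter_add_sdiff (ψ (PolyCone.ofSubspace L)) hN (isBiconic_genericPairs ⊥),
    hbot, htop, add_zero, add_zero]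

theorem ofSubspace_apply_compl_zero [NeZero d] (hψ : IsLocalInvariant ψ) :
    ψ (PolyCone.ofSubspace L) {0}ᶜ = ψ (PolyCone.ofSubspace L) (genericPairs L) := by
  have h := hψ.ofSubspace_apply_inter_genericPairs
    (isBiconic_zero.compl.inter (isBiconic_biconicLift (PolyCone.ofSubspace L)))
    Set.inter_subset_right fun h => h.1 rfl
  rw [hψ.concentrated _ _ isBiconic_zero.compl, ← h]
  congr 1
  exact Set.inter_eq_right.2 fun p hp =>
    ⟨fun hp0 => zero_notMem_genericPairs L (hp0 ▸ hp), genericPairs_subset_biconicLift L hp⟩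

theorem ofSubspace_apply [NeZero d] (hψ : IsLocalInvariant ψ) (hM : IsBiconic M)
    (hML : M ⊆ biconicLift (PolyCone.ofSubspace L)) (h0 : 0 ∉ M) :
    ψ (PolyCone.ofSubspace L) M = ψ (PolyCone.ofSubspace L) {0}ᶜ * gaussianSplit L M := by
  rw [← hψ.ofSubspace_apply_inter_genericPairs hM hML h0,
    hψ.ofSubspace_apply_of_subset_genericPairs (hM.inter (isBiconic_genericPairs L))
      Set.inter_subset_right, gaussianSplit_inter_genericPairs L hM, hψ.ofSubspace_apply_compl_zero]

theorem apply_of_subset_biconicLift [NeZero d] (hψ : IsLocalInvariant ψ)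
    (L : Fin (d + 1) → Submodule ℝ (Euc d)) (hL : ∀ k, Module.finrank ℝ (L k) = k)
    (hM : IsBiconic M) (hMC : M ⊆ biconicLift C) (h0 : 0 ∉ M) :
    ψ C M = ∑ k : Fin (d + 1), ψ (PolyCone.ofSubspace (L k)) {0}ᶜ * supportMeasure k C M := by
  have hMV (V : Submodule ℝ (Euc d)) := hM.inter (isBiconic_interiorPairs V C)
  have apply_inter_interiorPairs {V : Submodule ℝ (Euc d)} {k : Fin (d + 1)}
      (hV : Module.finrank ℝ V = k) : ψ C (M ∩ interiorPairs V C) =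
        ψ (PolyCone.ofSubspace (L k)) {0}ᶜ * gaussianSplit V (M ∩ interiorPairs V C) := by
    have hsub := inter_interiorPairs_subset (L := V) hMC
    rw [hψ.congr (hMV V) (Set.inter_subset_left.trans hMC) hsub,
      hψ.ofSubspace_apply (hMV V) hsub fun h => h0 h.1,
      hψ.ofSubspace_apply_compl_zero_congr (hV.trans (hL k).symm)]
  let dim (V : Submodule ℝ (Euc d)) : Fin (d + 1) :=
    ⟨Module.finrank ℝ V, Nat.lt_succ_of_le (by simpa using V.finrank_le)⟩
  calc ψ C M = ψ C (⋃ V ∈ C.faceSubspaces, M ∩ interiorPairs V C) := by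
        rw [biUnion_inter_interiorPairs hMC]
    _ = ∑ V ∈ C.faceSubspaces, ψ C (M ∩ interiorPairs V C) :=
        VectorMeasure.of_biUnion_finset (v := ψ C) ((pairwiseDisjoint_interiorPairs C).mono_on
          fun V _ => Set.inter_subset_right) fun V _ => hMV V
    _ = ∑ k, ∑ V ∈ C.faceSubspaces with dim V = k, ψ C (M ∩ interiorPairs V C) :=
        (Finset.sum_fiberwise _ dim _).symm
    _ = ∑ k : Fin (d + 1), ψ (PolyCone.ofSubspace (L k)) {0}ᶜ * supportMeasure k C M := by
        simp only [supportMeasure_eq_sum hM hMC, Finset.mul_sum, dim, Fin.ext_iff]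
        exact Finset.sum_congr rfl fun k _ => Finset.sum_congr rfl fun V hV =>
          apply_inter_interiorPairs (Finset.mem_filter.1 hV).2

theorem apply_inter_zero (hψ : IsLocalInvariant ψ) (C : PolyCone d) (M : Set (Euc d × Euc d)) :
    ψ C (M ∩ {0}) = ψ (PolyCone.ofSubspace ⊤) {0} * biDirac M := by
  by_cases h0 : (0 : Euc d × Euc d) ∈ M
  · rw [Set.inter_eq_right.2 (Set.singleton_subset_iff.2 h0), hψ.congr isBiconic_zero
      (Set.singleton_subset_iff.2 (zero_mem_biconicLift C))
      (Set.singleton_subset_iff.2 (zero_mem_biconicLift (PolyCone.ofSubspace ⊤)))]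
    simp [biDirac, measureReal_def, h0]
  · rw [Set.inter_singleton_eq_empty.2 h0, VectorMeasure.empty]
    simp [biDirac, measureReal_def, h0]

theorem apply_sdiff_zero (hψ : IsLocalInvariant ψ) (L : Fin (d + 1) → Submodule ℝ (Euc d))
    (hL : ∀ k, Module.finrank ℝ (L k) = k) (C : PolyCone d) (hM : IsBiconic M) :
    ψ C (M \ {0}) =
      ∑ k : Fin (d + 1), ψ (PolyCone.ofSubspace (L k)) {0}ᶜ * supportMeasure k C M := by
  rcases Nat.eq_zero_or_pos d with rfl | hd
  · have hM0 : M \ {0} = ∅ := Set.sdiff_eq_empty.2 fun p _ => Subsingleton.elim p 0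
    have h0 : ({0}ᶜ : Set (Euc 0 × Euc 0)) = ∅ :=
      Set.compl_empty_iff.2 (Set.eq_univ_of_forall fun p => Subsingleton.elim p 0)
    simp [hM0, h0]
  · have : NeZero d := ⟨hd.ne'⟩
    have hN := (hM.inter (isBiconic_biconicLift C)).diff isBiconic_zero
    rw [hψ.concentrated C _ (hM.diff isBiconic_zero), Set.sdiff_inter_right_comm,
      hψ.apply_of_subset_biconicLift L hL hN (Set.sdiff_subset.trans Set.inter_subset_right)
        fun h => h.2 rfl]
    simp only [supportMeasure_inter_sdiff]

theorem eq_sum (hψ : IsLocalInvariant ψ) (L : Fin (d + 1) → Submodule ℝ (Euc d))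
    (hL : ∀ k, Module.finrank ℝ (L k) = k) (C : PolyCone d) (hM : IsBiconic M) :
    ψ C M = ψ (PolyCone.ofSubspace ⊤) {0} * biDirac M +
      ∑ k : Fin (d + 1), ψ (PolyCone.ofSubspace (L k)) {0}ᶜ * supportMeasure k C M := by
  rw [biconicMeasure_eq_inter_add_sdiff (ψ C) hM isBiconic_zero, hψ.apply_inter_zero,
    hψ.apply_sdiff_zero L hL C hM]

end IsLocalInvariant

end Characterization

theorem mainTheorem4_general (d : ℕ) (ψ : PolyCone d → BiconicMeasure d)
    (hψ : IsLocalInvariant ψ) :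
    (∃ (r : ℝ) (c : Fin (d + 1) → ℝ), ∀ (C : PolyCone d) (M : Set (Euc d × Euc d)),
      IsBiconic M → ψ C M = r * biDirac M + ∑ k : Fin (d + 1), c k * supportMeasure k C M) ∧
    ∀ L : Fin (d + 1) → Submodule ℝ (Euc d), (∀ k, Module.finrank ℝ (L k) = k) →
      ∀ (C : PolyCone d) (M : Set (Euc d × Euc d)), IsBiconic M →
        ψ C M = ψ (PolyCone.ofSubspace ⊤) {0} * biDirac M +
          ∑ k : Fin (d + 1),
            ψ (PolyCone.ofSubspace (L k)) {0}ᶜ * supportMeasure k C M := by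
  choose L hL using fun k : Fin (d + 1) => exists_submodule_finrank_eq (Nat.le_of_lt_succ k.2)
  exact ⟨⟨_, _, fun C M hM => hψ.eq_sum L hL C hM⟩, fun L hL C M hM => hψ.eq_sum L hL C hM⟩

theorem mainTheorem4 (d : ℕ) (ψ : PolyCone d → BiconicMeasure d)
    (concentrated : ∀ (C : PolyCone d) (M : Set (Euc d × Euc d)), IsBiconic M →
      ψ C M = ψ C (M ∩ biconicLift C))
    (invariant : ∀ (Q : Euc d ≃ₗᵢ[ℝ] Euc d) (C : PolyCone d) (M : Set (Euc d × Euc d)),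
      IsBiconic M → ψ (C.map Q) (biRotate Q M) = ψ C M)
    (local_on_lift : ∀ (C D : PolyCone d) (M : Set (Euc d × Euc d)), IsBiconic M →
      biconicLift C ∩ M = biconicLift D ∩ M → ψ C M = ψ D M) :
    (∃ (r : ℝ) (c : Fin (d + 1) → ℝ), ∀ (C : PolyCone d) (M : Set (Euc d × Euc d)),
      IsBiconic M → ψ C M = r * biDirac M + ∑ k : Fin (d + 1), c k * supportMeasure k C M) ∧
    ∀ L : Fin (d + 1) → Submodule ℝ (Euc d), (∀ k, Module.finrank ℝ (L k) = k) →
      ∀ (C : PolyCone d) (M : Set (Euc d × Euc d)), IsBiconic M →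
        ψ C M = ψ (PolyCone.ofSubspace ⊤) {0} * biDirac M +
          ∑ k : Fin (d + 1),
            ψ (PolyCone.ofSubspace (L k)) {0}ᶜ * supportMeasure k C M :=
  mainTheorem4_general d ψ ⟨concentrated, fun Q _ M hM => invariant Q _ M hM, local_on_lift⟩
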